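/- Let $\omega=\{0,1,2,\dots\}$, let $[A]^\omega$ be the family of infinite subsets of $A\subseteq\omega$, and let $[A]^2$ be the set of unordered pairs of distinct elements of $A$. For $\rho:\mathcal F\to\mathcal P(\Lambda)$ with $\mathcal F\subseteq\mathcal P(\Omega)$, where $\mathcal F$ is closed under removing finite sets, put $$\mathcal I_\rho=\{A\subseteq\Lambda:\ \forall F\in\mathcal F\ \ \rho(F)\not\subseteq A\}.$$ For infinite sets $D,H,E\subseteq\omega$ let $$FS(D)=\Big\{\sum_{n\in\alpha}n:\ \emptyset\ne\alpha\subseteq D\text{ finite}\Big\},\qquad r(H)=[H]^2\subseteq[\omega]^2,\qquad \Delta(E)=\{a-b:\ a,b\in E,\ a>b\},$$ and let $\mathcal H=\mathcal I_{FS}$ (on $\omega$), $\mathcal R=\mathcal I_r$ (on $[\omega]^2$), $\mathcal D=\mathcal I_\Delta$ (on $\omega$). Let $\mathcal I_{1/n}=\{A\subseteq\omega:\sum_{n\in A}\frac1{n+1}<\infty\}$, and let $\mathcal W$ be the family of those $A\subseteq\omega$ that do not contain arithmetic progressions of arbitrary finite length (with positive common difference). For an ideal $\mathcal I$ on $\Lambda$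 let $\rho_{\mathcal I}$ be the function defined on $\mathcal I^+=\mathcal P(\Lambda)\setminus\mathcal I$ by $\rho_{\mathcal I}(A)=A$. For ideals $\mathcal I_i$ on $\Lambda_i$, write $\mathcal I_2\le_K\mathcal I_1$ if there is $\phi:\Lambda_1\to\Lambda_2$ with $\phi[A]\notin\mathcal I_2$ for every $A\notin\mathcal I_1$. For functions $\rho_i:\mathcal F_i\to\mathcal P(\Lambda_i)$ as above, with $\mathcal F_i\subseteq\mathcal P(\Omega_i)$, write $\rho_2\le_K\rho_1$ if there is $\phi:\Lambda_1\to\Lambda_2$ such that for every $F_1\in\mathcal F_1$ there is $F_2\in\mathcal F_2$ such that for every finite $K_1\subseteq\Omega_1$ there is a finite $K_2\subseteq\Omega_2$ with $\rho_2(F_2\setminus K_2)\subseteq\phi[\rho_1(F_1\setminus K_1)]$. Then: 1. $\mathcal H\not\le_K\mathcal R$ and $FS\not\le_K r$. 2. $\mathcal R\not\le_K\mathcal H$ and $r\not\le_K FS$. 3. $\Delta\le_K FS$, $\mathcal D\subseteq\mathcal H$ and $\mathcal D\le_K\mathcal H$. 4. $\Delta\le_K r$ and $\mathcal D\le_K\mathcal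 R$. 5. $\mathcal R\not\le_K\mathcal D$ and $r\not\le_K\Delta$. 6. $\mathcal H\not\le_K\mathcal D$ and $FS\not\le_K\Delta$. 7. $\mathcal I_{1/n}\not\le_K\mathcal R$ and $\rho_{\mathcal I_{1/n}}\not\le_K r$. 8. $\mathcal I_{1/n}\not\le_K\mathcal H$ and $\rho_{\mathcal I_{1/n}}\not\le_K FS$. 9. $\mathcal I_{1/n}\not\le_K\mathcal D$ and $\rho_{\mathcal I_{1/n}}\not\le_K\Delta$. 10. $\mathcal I_{1/n}\not\le_K\mathcal W$ and $\rho_{\mathcal I_{1/n}}\not\le_K\rho_{\mathcal W}$. 11. $\mathcal D\not\le_K\mathcal I_{1/n}$ and $\Delta\not\le_K\rho_{\mathcal I_{1/n}}$. 12. $\mathcal H\not\le_K\mathcal I_{1/n}$ and $FS\not\le_K\rho_{\mathcal I_{1/n}}$. 13. $\mathcal R\not\le_K\mathcal I_{1/n}$ and $r\not\le_K\rho_{\mathcal I_{1/n}}$. 14. $\mathcal D\not\le_K\mathcal W$ and $\Delta\not\le_K\rho_{\mathcal W}$. 15. $\mathcal H\not\le_K\mathcal W$ and $FS\not\le_K\rho_{\mathcal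 W}$. 16. $\mathcal R\not\le_K\mathcal W$ and $r\not\le_K\rho_{\mathcal W}$. -/

import Mathlib

namespace Katetov

/-- The data of a function `ρ : 𝓕 → 𝒫(Λ)` with `𝓕 ⊆ 𝒫(Ω)`. Only the values `ρ.map F` with
`F ∈ ρ.dom` matter. Partition regular functions are considered as such data. -/
structure SetOp (Ω Λ : Type*) where
  /-- the family `𝓕` on which `ρ` is defined -/
  dom : Set (Set Ω)
  /-- the values of `ρ` -/
  map : Set Ω → Set Λ

/-- The family `I_ρ` of the sets `A ⊆ Λ` that contain no `ρ(F)` with `F ∈ 𝓕`. -/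
def SetOp.ideal {Ω Λ : Type*} (ρ : SetOp Ω Λ) : Set (Set Λ) :=
  {A | ∀ F ∈ ρ.dom, ¬ ρ.map F ⊆ A}

/-- The function `ρ_I : I⁺ → 𝒫(Λ)`, `ρ_I(A) = A`. -/
def SetOp.ofIdeal {Λ : Type*} (I : Set (Set Λ)) : SetOp Λ Λ where
  dom := {A | A ∉ I}
  map A := A

/-- The Katětov order between ideals: `IdealLE I₂ I₁` is `I₂ ≤_K I₁`. -/
def IdealLE {Λ₂ Λ₁ : Type*} (I₂ : Set (Set Λ₂)) (I₁ : Set (Set Λ₁)) : Prop :=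
  ∃ φ : Λ₁ → Λ₂, ∀ A : Set Λ₁, A ∉ I₁ → φ '' A ∉ I₂

/-- The Katětov order between partition regular functions: `SetOp.LE ρ₂ ρ₁` is `ρ₂ ≤_K ρ₁`. -/
def SetOp.LE {Ω₂ Λ₂ Ω₁ Λ₁ : Type*} (ρ₂ : SetOp Ω₂ Λ₂) (ρ₁ : SetOp Ω₁ Λ₁) : Prop :=
  ∃ φ : Λ₁ → Λ₂, ∀ F₁ ∈ ρ₁.dom, ∃ F₂ ∈ ρ₂.dom, ∀ K₁ : Set Ω₁, K₁.Finite →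
    ∃ K₂ : Set Ω₂, K₂.Finite ∧ ρ₂.map (F₂ \ K₂) ⊆ φ '' ρ₁.map (F₁ \ K₁)

/-- `[ω]²`, the unordered pairs of distinct natural numbers. -/
abbrev Pairs : Type := {s : Finset ℕ // s.card = 2}

/-- `FS(D)`: the sums of finite nonempty sets of (distinct) elements of `D`. -/
def FS : SetOp ℕ ℕ where
  dom := {D | D.Infinite}
  map D := {n | ∃ α : Finset ℕ, α.Nonempty ∧ (α : Set ℕ) ⊆ D ∧ n = ∑ i ∈ α, i}

/-- `r(H) = [H]²`. -/
def r : SetOp ℕ Pairs where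
  dom := {H | H.Infinite}
  map H := {p | (p.1 : Set ℕ) ⊆ H}

/-- `Δ(E)`: the positive differences of elements of `E`. -/
def Δ : SetOp ℕ ℕ where
  dom := {E | E.Infinite}
  map E := {d | ∃ a ∈ E, ∃ b ∈ E, b < a ∧ d = a - b}

/-- The Hindman ideal `I_FS`. -/
def hindman : Set (Set ℕ) := FS.ideal

/-- The Ramsey ideal `I_r`. -/
def ramsey : Set (Set Pairs) := r.ideal

/-- The ideal `𝒟 = I_Δ`. -/
def diff : Set (Set ℕ) := Δ.ideal

/-- The summable ideal `I_{1/n}`. -/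
def summable : Set (Set ℕ) := {A | Summable fun n : A => 1 / (((n : ℕ) : ℝ) + 1)}

/-- AP-sets: sets containing arithmetic progressions of arbitrary finite length. -/
def IsAPSet (A : Set ℕ) : Prop :=
  ∀ k : ℕ, ∃ a d : ℕ, 0 < d ∧ ∀ i < k, a + i * d ∈ A

/-- The van der Waerden ideal. -/
def vdW : Set (Set ℕ) := {A | ¬ IsAPSet A}

end Katetov

/-!
For each non-reduction, every `φ : Λ₁ → Λ₂` maps some positive set to a set of the target ideal.
The positive set is built by recursion along an ultrafilter `p` on which `φ`, or a function derived
from it, is either constant or tends to infinity.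

* Source `𝓘_{1/n}` or `𝓦`: every member of `p` is positive, and positivity is witnessed by finite
  sets. If `φ → ∞` along `p`, choose the `n`-th witness so that its `φ`-values lie far beyond the
  earlier ones and are congruent modulo `n + 1`; then each difference occurs only finitely often
  among the values.
* Source `[ω]²`: either `φ {i, x}` depends in the limit on `i` or `x` alone, and a lacunary choice
  suffices, or its rows are eventually distinct, and `x` can be chosen so that the values
  `φ {i, x}`, over the earlier points `i`, form a Sidon-like set, whereas a set of finite sums
  contains parallelograms `y, y + a, y + b, y + a + b`.
* Source `FS`: let `p` be idempotent. A function `a` is either stable (`a (x + y) = a x`) or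
  divergent (`a (x + y) → ∞` as `y → ∞`), so the image of a suitable `FS`-set is governed by the
  first, respectively the last, term of a sum. For `φ` with values in `[ω]²`, this dichotomy is
  applied to both coordinates.

Since `Δ ≤ FS` (differences of partial sums) and `Δ ≤ r`, the other cases follow by transitivity.
-/

namespace Katetov

open Filter

/-! ### Katětov orders -/

theorem IdealLE.trans {Λ₁ Λ₂ Λ₃ : Type*} {I₁ : Set (Set Λ₁)} {I₂ : Set (Set Λ₂)}
    {I₃ : Set (Set Λ₃)} (h₃₂ : IdealLE I₃ I₂) (h₂₁ : IdealLE I₂ I₁) : IdealLE I₃ I₁ := by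
  obtain ⟨φ, hφ⟩ := h₃₂
  obtain ⟨ψ, hψ⟩ := h₂₁
  exact ⟨φ ∘ ψ, fun A hA => by rw [Set.image_comp]; exact hφ _ (hψ A hA)⟩

/-- The domain of `ρ` is closed under removing finite sets. -/
def SetOp.DiffClosed {Ω Λ : Type*} (ρ : SetOp Ω Λ) : Prop :=
  ∀ F ∈ ρ.dom, ∀ K : Set Ω, K.Finite → F \ K ∈ ρ.dom

theorem diffClosed_FS : FS.DiffClosed := fun _ hF _ => Set.Infinite.sdiff hF

theorem diffClosed_r : r.DiffClosed := fun _ hF _ => Set.Infinite.sdiff hF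

theorem diffClosed_Δ : Δ.DiffClosed := fun _ hF _ => Set.Infinite.sdiff hF

section

variable {Ω Ω' Λ Λ' : Type*} {ρ : SetOp Ω Λ} {ρ' : SetOp Ω' Λ'}
  {I : Set (Set Λ)} {I' : Set (Set Λ')}

theorem SetOp.notMem_ideal_iff {A : Set Λ} : A ∉ ρ.ideal ↔ ∃ F ∈ ρ.dom, ρ.map F ⊆ A := by
  simp only [SetOp.ideal, Set.mem_ofPred_eq, not_forall, not_not, exists_prop]

theorem SetOp.isLowerSet_ideal (ρ : SetOp Ω Λ) : IsLowerSet ρ.ideal :=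
  fun _ _ hAB hB F hF hFA => hB F hF (hFA.trans hAB)

theorem SetOp.LE.idealLE (hρ : ρ.DiffClosed) (h : SetOp.LE ρ ρ') : IdealLE ρ.ideal ρ'.ideal := by
  obtain ⟨φ, hφ⟩ := h
  refine ⟨φ, fun A hA => ?_⟩
  obtain ⟨F', hF', hA⟩ := SetOp.notMem_ideal_iff.1 hA
  obtain ⟨F, hF, h⟩ := hφ F' hF'
  obtain ⟨K, hK, hsub⟩ := h ∅ Set.finite_empty
  rw [Set.sdiff_empty] at hsub
  exact SetOp.notMem_ideal_iff.2 ⟨F \ K, hρ F hF K hK, hsub.trans (Set.image_mono hA)⟩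

theorem not_idealLE_and_not_le (hI : ρ.ideal = I) (hI' : ρ'.ideal = I') (hρ : ρ.DiffClosed)
    (h : ¬ IdealLE I I') : ¬ IdealLE I I' ∧ ¬ SetOp.LE ρ ρ' := by
  subst hI hI'
  exact ⟨h, fun hle => h (hle.idealLE hρ)⟩

theorem not_idealLE_of_forall (h : ∀ φ : Λ' → Λ, ∃ F ∈ ρ'.dom, φ '' ρ'.map F ∈ I) :
    ¬ IdealLE I ρ'.ideal := by
  rintro ⟨φ, hφ⟩
  obtain ⟨F, hF, hI⟩ := h φ
  exact hφ (ρ'.map F) (SetOp.notMem_ideal_iff.2 ⟨F, hF, subset_rfl⟩) hI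

theorem ideal_ofIdeal (hI : IsLowerSet I) : (SetOp.ofIdeal I).ideal = I := by
  ext A
  exact ⟨fun h => by_contra fun hA => h A hA subset_rfl, fun hA F hF hFA => hF (hI hFA hA)⟩

end

/-! ### Ultrafilters and recursive constructions -/

theorem eventually_eq_or_tendsto_atTop {X : Type*} (p : Ultrafilter X) (g : X → ℕ) :
    (∃ c, ∀ᶠ x in p, g x = c) ∨ Tendsto g p atTop := by
  rcases Ultrafilter.le_cofinite_or_eq_pure (p.map g) with h | ⟨c, hc⟩
  · exact .inr (h.trans_eq Nat.cofinite_eq_atTop)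
  · refine .inl ⟨c, ?_⟩
    have : {c} ∈ p.map g := by rw [hc]; exact Ultrafilter.mem_pure.2 rfl
    exact this

theorem eventually_rows_eq_or_tendsto_atTop {X Y : Type*} (p : Ultrafilter X) (q : Ultrafilter Y)
    (f : X → Y → ℕ) :
    (∃ g : X → ℕ, ∀ᶠ i in p, ∀ᶠ x in q, f i x = g i) ∨ ∀ᶠ i in p, Tendsto (f i) q atTop := by
  refine (Ultrafilter.eventually_or.1 <| Eventually.of_forall fun i =>
    eventually_eq_or_tendsto_atTop q (f i)).imp_left fun h => ?_
  choose! g hg using fun i (hi : ∃ c, ∀ᶠ x in q, f i x = c) => hi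
  exact ⟨g, h.mono hg⟩

theorem exists_ultrafilter_forall_notMem.{u} {X : Type u} {I : Set (Set X)} (hI : IsLowerSet I)
    (h : ∀ (κ : Type u) [Finite κ] (C : X → κ), ∃ c, C ⁻¹' {c} ∉ I) :
    ∃ p : Ultrafilter X, ∀ A ∈ p, A ∉ I := by
  obtain ⟨p, hp⟩ := Ultrafilter.exists_ultrafilter_of_finite_inter_nonempty {A | Aᶜ ∈ I} <| by
    intro T hT
    by_contra hne
    have hcover : ∀ x, ∃ A : T, x ∉ A.1 := fun x => by
      by_contra! hx
      exact hne ⟨x, Set.mem_sInter.2 fun A hA => hx ⟨A, hA⟩⟩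
    choose C hC using hcover
    obtain ⟨A, hA⟩ := h T C
    exact hA (hI (fun x (hx : C x = A) => hx ▸ hC x) (hT A.2))
  exact ⟨p, fun A hA hAI => Ultrafilter.compl_notMem_iff.2 hA (hp (by simpa using hAI))⟩

theorem exists_seq_of_history {α : Type*} [DecidableEq α] {Inv : Finset α → Prop}
    {Q : ℕ → Finset α → α → Prop} (h0 : Inv ∅)
    (h : ∀ n s, Inv s → ∃ y, Q n s y ∧ Inv (insert y s)) :
    ∃ f : ℕ → α, ∀ n, Inv ((Finset.range n).image f) ∧ Q n ((Finset.range n).image f) (f n) := by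
  have : Nonempty α := (h 0 ∅ h0).nonempty
  choose! g hgQ hgI using h
  let S : ℕ → Finset α := fun n => Nat.rec ∅ (fun k s => insert (g k s) s) n
  have hS (n : ℕ) : Inv (S n) := by
    induction n with
    | zero => exact h0
    | succ k ih => exact hgI k _ ih
  have hSf (n : ℕ) : S n = (Finset.range n).image fun k => g k (S k) := by
    induction n with
    | zero => rfl
    | succ k ih => rw [Finset.range_add_one, Finset.image_insert, ← ih]
  exact ⟨fun k => g k (S k), fun n => hSf n ▸ ⟨hS n, hgQ n _ (hS n)⟩⟩

theorem exists_strictMono_of_eventually {p : Filter ℕ} [p.NeBot] (hp : p ≤ atTop)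
    {Inv : Finset ℕ → Prop} {Q : ℕ → Finset ℕ → ℕ → Prop} (h0 : Inv ∅)
    (h : ∀ n s, Inv s → ∀ᶠ y in p, Q n s y ∧ Inv (insert y s)) :
    ∃ f : ℕ → ℕ, StrictMono f ∧ ∀ n, Inv ((Finset.range n).image f) ∧
      Q n ((Finset.range n).image f) (f n) := by
  have hlt (s : Finset ℕ) : ∀ᶠ y in p, ∀ i ∈ s, i < y :=
    (eventually_all_finset s).2 fun i _ => hp (eventually_gt_atTop i)
  obtain ⟨f, hf⟩ := exists_seq_of_history (Q := fun n s y => Q n s y ∧ ∀ i ∈ s, i < y) h0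
    fun n s hs => ((h n s hs).and (hlt s)).exists.imp fun y hy => ⟨⟨hy.1.1, hy.2⟩, hy.1.2⟩
  refine ⟨f, strictMono_nat_of_lt_succ fun n => (hf (n + 1)).2.2 _ ?_, fun n =>
    ⟨(hf n).1, (hf n).2.1⟩⟩
  exact Finset.mem_image_of_mem f (Finset.self_mem_range_succ n)

theorem exists_strictMono_pairwise {p : Filter ℕ} [p.NeBot] (hp : p ≤ atTop)
    {R : ℕ → ℕ → Prop} (h : ∀ᶠ i in p, ∀ᶠ x in p, R i x) :
    ∃ f : ℕ → ℕ, StrictMono f ∧ ∀ m n, m < n → R (f m) (f n) := by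
  obtain ⟨f, hf, hR⟩ := exists_strictMono_of_eventually hp
    (Inv := fun s => ∀ i ∈ s, ∀ᶠ x in p, R i x) (Q := fun _ s x => ∀ i ∈ s, R i x) (by simp)
    fun _ s hs => by
      filter_upwards [(eventually_all_finset s).2 hs, h] with y hy hRy
      exact ⟨hy, Finset.forall_mem_insert _ _ _ |>.2 ⟨hRy, hs⟩⟩
  exact ⟨f, hf, fun m n hmn => (hR n).2 _ <|
    Finset.mem_image_of_mem f (Finset.mem_range.2 hmn)⟩

/-! ### The summable ideal -/

theorem mem_summable_iff {A : Set ℕ} :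
    A ∈ summable ↔ Summable (A.indicator fun n : ℕ => 1 / ((n : ℝ) + 1)) :=
  summable_subtype_iff_indicator (f := fun n : ℕ => 1 / ((n : ℝ) + 1))

theorem isLowerSet_summable : IsLowerSet summable := by
  intro B A hAB hB
  rw [mem_summable_iff] at *
  simpa only [Set.indicator_indicator, Set.inter_eq_left.2 hAB] using hB.indicator A

theorem mem_summable_of_finite {A : Set ℕ} (hA : A.Finite) : A ∈ summable :=
  mem_summable_iff.2 (summable_of_hasFiniteSupport (hA.subset Set.support_indicator_subset))

theorem union_mem_summable {A B : Set ℕ} (hA : A ∈ summable) (hB : B ∈ summable) :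
    A ∪ B ∈ summable := by
  have hBA : B \ A ∈ summable := isLowerSet_summable Set.sdiff_subset hB
  rw [mem_summable_iff] at *
  rw [← Set.union_sdiff_self, Set.indicator_union_of_disjoint Set.disjoint_sdiff_right]
  exact hA.add hBA

theorem diffClosed_ofIdeal_summable : (SetOp.ofIdeal summable).DiffClosed := by
  intro A hA K hK hAK
  exact hA (isLowerSet_summable (Set.subset_sdiff_union A K)
    (union_mem_summable hAK (mem_summable_of_finite hK)))

theorem univ_notMem_summable : Set.univ ∉ summable := by
  rw [mem_summable_iff, Set.indicator_univ]
  intro h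
  refine Real.not_summable_one_div_natCast ((summable_nat_add_iff 1).1 ?_)
  simpa only [Nat.cast_add, Nat.cast_one] using h

theorem exists_preimage_singleton_notMem_summable {κ : Type*} [Finite κ] (C : ℕ → κ) :
    ∃ c, C ⁻¹' {c} ∉ summable := by
  by_contra! hC
  have hpre (s : Set κ) : C ⁻¹' s ∈ summable := by
    induction s, s.toFinite using Set.Finite.induction_on with
    | empty => exact mem_summable_of_finite Set.finite_empty
    | insert _ _ ih =>
      rw [Set.insert_eq, Set.preimage_union]
      exact union_mem_summable (hC _) ih
  exact univ_notMem_summable (hpre Set.univ)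

theorem mem_summable_of_levels {B : Set ℕ} {L : ℕ → Finset ℕ} (hB : B ⊆ ⋃ n, (L n : Set ℕ))
    (hcard : ∀ n, (L n).card ≤ 2 ^ n) (hL : ∀ n, ∀ x ∈ L n, 4 ^ n ≤ x) : B ∈ summable := by
  have hlevel (n : ℕ) : ∑ x ∈ L n, 1 / ((x : ℝ) + 1) ≤ (1 / 2) ^ n := by
    calc ∑ x ∈ L n, 1 / ((x : ℝ) + 1) ≤ ∑ _x ∈ L n, 1 / (4 : ℝ) ^ n := by
          refine Finset.sum_le_sum fun x hx => ?_
          have : (4 : ℝ) ^ n ≤ x := mod_cast hL n x hx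
          gcongr
          linarith
      _ ≤ 2 ^ n * (1 / 4 ^ n) := by
          rw [Finset.sum_const, nsmul_eq_mul]
          gcongr
          exact_mod_cast hcard n
      _ = (1 / 2) ^ n := by
          rw [← one_div_pow, ← mul_pow]
          norm_num
  have hsigma : Summable fun x : Σ n, L n => 1 / (((x.2 : ℕ) : ℝ) + 1) := by
    refine (summable_sigma_of_nonneg fun x => by positivity).2 ⟨fun n => .of_finite, ?_⟩
    refine .of_nonneg_of_le (fun n => by positivity) (fun n => ?_) summable_geometric_two
    exact ((L n).tsum_subtype fun x : ℕ => 1 / ((x : ℝ) + 1)).trans_le (hlevel n)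
  choose N hN using fun x : B => Set.mem_iUnion.1 (hB x.2)
  have hinj : Function.Injective fun x : B => (⟨N x, x, hN x⟩ : Σ n, L n) := fun x y h =>
    Subtype.ext (congrArg (fun z : Σ n, L n => (z.2 : ℕ)) h)
  simpa only [summable, Set.mem_ofPred_eq, Function.comp_def] using hsigma.comp_injective hinj

/-! ### Differences and finite sums -/

theorem mem_diff_of_finite_gaps {B : Set ℕ}
    (h : ∀ d, 0 < d → {y | y ∈ B ∧ y + d ∈ B}.Finite) : B ∈ diff := by
  intro E (hE : E.Infinite) hsub
  obtain ⟨b, hb⟩ := hE.nonempty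
  obtain ⟨a, ha, hba⟩ := hE.exists_gt b
  have hinj : Set.InjOn (fun e => e - a) (E \ Set.Iic a) := fun x hx y hy hxy => by
    simp only [Set.mem_sdiff, Set.mem_Iic, not_le] at hx hy hxy
    omega
  refine ((hE.sdiff (Set.finite_Iic a)).image hinj) ((h (a - b) (by omega)).subset ?_)
  rintro _ ⟨e, ⟨he, hea⟩, rfl⟩
  rw [Set.mem_Iic, not_le] at hea
  exact ⟨hsub ⟨e, he, a, ha, hea, rfl⟩, hsub ⟨e, he, b, hb, by omega, by dsimp only; omega⟩⟩

theorem mem_diff_of_finite {B : Set ℕ} (hB : B.Finite) : B ∈ diff :=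
  mem_diff_of_finite_gaps fun _ _ => hB.subset fun _ hy => hy.1

theorem mem_diff_of_levels {B : Set ℕ} {L : ℕ → Finset ℕ} (hB : B ⊆ ⋃ n, (L n : Set ℕ))
    (hsep : ∀ m n, m < n → ∀ u ∈ L m, ∀ v ∈ L n, 2 * u < v)
    (hgap : ∀ n, ∀ u ∈ L n, ∀ v ∈ L n, u < v → n < v - u) : B ∈ diff := by
  refine mem_diff_of_finite_gaps fun d hd => ?_
  have hfin : (Set.Iio d ∪ ⋃ n ∈ Set.Iio d, (L n : Set ℕ)).Finite :=
    (Set.finite_Iio d).union ((Set.finite_Iio d).biUnion fun n _ => (L n).finite_toSet)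
  refine hfin.subset fun y hy => ?_
  obtain ⟨m, hm⟩ := Set.mem_iUnion.1 (hB hy.1)
  obtain ⟨n, hn⟩ := Set.mem_iUnion.1 (hB hy.2)
  rcases lt_trichotomy m n with hmn | rfl | hmn
  · have := hsep m n hmn y hm _ hn
    exact .inl (Set.mem_Iio.2 (by omega))
  · have := hgap m y hm _ hn (by omega)
    exact .inr (Set.mem_biUnion (Set.mem_Iio.2 (by omega)) hm)
  · have := hsep n m hmn _ hn y hm
    omega

theorem exists_partialSums {D : Set ℕ} (hD : D.Infinite) : ∃ E : Set ℕ, E.Infinite ∧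
    ∀ K : Set ℕ, K.Finite → ∃ L : Set ℕ, L.Finite ∧ Δ.map (E \ L) ⊆ FS.map (D \ K) := by
  classical
  have hDi : Infinite D := hD.to_subtype
  let d := Nat.orderEmbeddingOfSet D
  let σ (n : ℕ) : ℕ := ∑ i ∈ Finset.range n, d i
  have hdD (i : ℕ) : d i ∈ D := Nat.orderEmbeddingOfSet_range D ▸ Set.mem_range_self i
  have hσ : Monotone σ := fun m n hmn => Finset.sum_le_sum_of_subset (Finset.range_mono hmn)
  have hσ' : StrictMono fun n => σ (n + 1) := strictMono_nat_of_lt_succ fun n => by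
    have : d 0 < d (n + 1) := d.strictMono n.succ_pos
    simp only [σ, Finset.sum_range_succ _ (n + 1)]
    omega
  refine ⟨Set.range σ, (Set.infinite_range_of_injective hσ'.injective).mono ?_, fun K hK => ?_⟩
  · rintro _ ⟨n, rfl⟩
    exact ⟨n + 1, rfl⟩
  obtain ⟨N, hN⟩ := (hK.preimage d.injective.injOn).bddAbove
  refine ⟨σ '' Set.Iic N, (Set.finite_Iic N).image σ, ?_⟩
  rintro _ ⟨_, ⟨⟨n, rfl⟩, -⟩, _, ⟨⟨m, rfl⟩, hm⟩, hlt, rfl⟩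
  have hmn : m < n := hσ.reflect_lt hlt
  have hNm : N < m := not_le.1 fun h => hm ⟨m, h, rfl⟩
  refine ⟨(Finset.Ico m n).image d, (Finset.nonempty_Ico.2 hmn).image d, fun x hx => ?_, ?_⟩
  · obtain ⟨i, hi, rfl⟩ := Finset.mem_image.1 (Finset.mem_coe.1 hx)
    exact ⟨hdD i, fun hiK => ((Finset.mem_Ico.1 hi).1.trans (hN hiK)).not_gt hNm⟩
  · rw [Finset.sum_image d.injective.injOn]
    exact Nat.sub_eq_of_eq_add' (Finset.sum_range_add_sum_Ico _ hmn.le).symm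

theorem le_Δ_FS : SetOp.LE Δ FS := by
  refine ⟨id, fun D hD => ?_⟩
  obtain ⟨E, hE, h⟩ := exists_partialSums hD
  exact ⟨E, hE, fun K hK => by simpa only [Set.image_id] using h K hK⟩

theorem diff_subset_hindman : diff ⊆ hindman := by
  intro A hA D hD hsub
  obtain ⟨E, hE, h⟩ := exists_partialSums hD
  obtain ⟨L, hL, h⟩ := h ∅ Set.finite_empty
  rw [Set.sdiff_empty] at h
  exact hA (E \ L) (hE.sdiff hL) (h.trans hsub)

theorem mem_hindman_of_finite {B : Set ℕ} (hB : B.Finite) : B ∈ hindman :=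
  diff_subset_hindman (mem_diff_of_finite hB)

/-- `B` contains no nondegenerate parallelogram `y, y + a, y + b, y + a + b`. Such a parallelogram
is found in every set of finite sums, with `y` as large as we please compared to `a` and `b`. -/
def IsParallelogramFree (B : Set ℕ) : Prop :=
  ∀ y a b, 0 < a → a < b → y ∈ B → y + a ∈ B → y + b ∈ B → y + a + b ∉ B

theorem mem_hindman_of_levels {B : Set ℕ} {L : ℕ → Set ℕ} (hB : B ⊆ ⋃ n, L n)
    (hsep : ∀ m n, m < n → ∀ u ∈ L m, ∀ v ∈ L n, 2 * u < v)
    (hL : ∀ n, IsParallelogramFree (L n)) : B ∈ hindman := by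
  intro D (hD : D.Infinite) hsub
  obtain ⟨a, ha, ha0⟩ := hD.exists_gt 0
  obtain ⟨b, hb, hab⟩ := hD.exists_gt a
  obtain ⟨y, hy, hyab⟩ := hD.exists_gt (a + b)
  have hFS (α : Finset ℕ) (hα : ↑α ⊆ ({a, b} : Set ℕ)) : y + ∑ i ∈ α, i ∈ B := by
    have hyα : y ∉ α := fun h => by
      have := hα h
      simp only [Set.mem_insert_iff, Set.mem_singleton_iff] at this
      omega
    refine hsub ⟨insert y α, Finset.insert_nonempty y α, ?_, by rw [Finset.sum_insert hyα]⟩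
    rw [Finset.coe_insert]
    exact Set.insert_subset hy (hα.trans (Set.insert_subset ha (Set.singleton_subset_iff.2 hb)))
  obtain ⟨n, hn⟩ := Set.mem_iUnion.1 (hB (by simpa using hFS ∅ (by simp)))
  have hlevel (t : ℕ) (ht : t ≤ a + b) (hBt : y + t ∈ B) : y + t ∈ L n := by
    obtain ⟨m, hm⟩ := Set.mem_iUnion.1 (hB hBt)
    rcases lt_trichotomy m n with hmn | rfl | hmn
    · have := hsep m n hmn _ hm _ hn
      omega
    · exact hm
    · have := hsep n m hmn _ hn _ hm
      omega
  have hya := hlevel a (by omega) (by simpa using hFS {a} (by simp))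
  have hyb := hlevel b (by omega) (by simpa using hFS {b} (by simp))
  have hsum := hlevel (a + b) le_rfl
    (by simpa [Finset.sum_pair hab.ne] using hFS {a, b} (by simp))
  exact hL n y a b ha0 hab hn hya hyb ((add_assoc y a b).symm ▸ hsum)

theorem range_mem_summable_of_lacunary {u : ℕ → ℕ} (hpos : ∀ n, 0 < u n)
    (hu : ∀ m n, m < n → 4 * u m < u n) : Set.range u ∈ summable := by
  refine mem_summable_of_levels (L := fun n => {u n}) (by simp) (by simp [Nat.one_le_two_pow]) ?_
  intro n
  simp only [Finset.mem_singleton, forall_eq]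
  induction n with
  | zero => exact hpos 0
  | succ n ih =>
    have := hu n (n + 1) n.lt_succ_self
    omega

theorem range_mem_hindman_of_lacunary {u : ℕ → ℕ} (hu : ∀ m n, m < n → 4 * u m < u n) :
    Set.range u ∈ hindman := by
  refine mem_hindman_of_levels (L := fun n => {u n}) (by simp) ?_ ?_
  · rintro m n hmn _ rfl _ rfl
    have := hu m n hmn
    omega
  · intro n y a b ha _ (hy : y = u n) (hya : y + a = u n)
    omega

/-! ### Pairs and the Ramsey ideal -/

namespace Pairs

theorem nonempty (p : Pairs) : p.1.Nonempty := Finset.card_pos.1 (by rw [p.2]; exact two_pos)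

/-- The smaller element of a pair. -/
def lo (p : Pairs) : ℕ := p.1.min' p.nonempty

/-- The larger element of a pair. -/
def hi (p : Pairs) : ℕ := p.1.max' p.nonempty

/-- The pair `{i, j}` with `i < j`. -/
def mk (i j : ℕ) (h : i < j) : Pairs := ⟨{i, j}, Finset.card_pair h.ne⟩

@[simp] theorem lo_mk {i j : ℕ} (h : i < j) : (mk i j h).lo = i :=
  (Finset.min'_pair i j).trans (min_eq_left h.le)

@[simp] theorem hi_mk {i j : ℕ} (h : i < j) : (mk i j h).hi = j :=
  (Finset.max'_pair i j).trans (max_eq_right h.le)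

theorem lo_lt_hi (p : Pairs) : p.lo < p.hi :=
  Finset.min'_lt_max'_of_card p.1 (by rw [p.2]; exact one_lt_two)

theorem mk_lo_hi (p : Pairs) : mk p.lo p.hi p.lo_lt_hi = p := by
  refine Subtype.ext (Finset.eq_of_subset_of_card_le ?_ ?_)
  · exact Finset.insert_subset (p.1.min'_mem _) (Finset.singleton_subset_iff.2 (p.1.max'_mem _))
  · rw [p.2, (mk p.lo p.hi p.lo_lt_hi).2]

theorem ext {p q : Pairs} (hlo : p.lo = q.lo) (hhi : p.hi = q.hi) : p = q := by
  rw [← mk_lo_hi p, ← mk_lo_hi q]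
  simp only [hlo, hhi]

theorem exists_apply_lo_hi_eq {α : Type*} [Nonempty α] (φ : Pairs → α) :
    ∃ f : ℕ → ℕ → α, ∀ p, f p.lo p.hi = φ p :=
  ⟨fun i j => if h : i < j then φ (mk i j h) else Classical.arbitrary α, fun p =>
    (dif_pos p.lo_lt_hi).trans (congrArg φ p.mk_lo_hi)⟩

end Pairs

theorem mk_mem_map_r {H : Set ℕ} {i j : ℕ} (hi : i ∈ H) (hj : j ∈ H) (h : i < j) :
    Pairs.mk i j h ∈ r.map H := by
  simp only [r, Pairs.mk, Set.mem_ofPred_eq, Finset.coe_pair]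
  exact Set.insert_subset hi (Set.singleton_subset_iff.2 hj)

theorem le_Δ_r : SetOp.LE Δ r := by
  refine ⟨fun p => p.hi - p.lo, fun H hH => ⟨H, hH, fun K hK => ⟨K, hK, ?_⟩⟩⟩
  rintro _ ⟨a, ha, b, hb, hba, rfl⟩
  exact ⟨Pairs.mk b a hba, mk_mem_map_r hb ha hba, by simp only [Pairs.hi_mk, Pairs.lo_mk]⟩

theorem mem_ramsey_of_lo_ne_hi {B : Set Pairs} (hB : ∀ p ∈ B, ∀ q ∈ B, p.lo ≠ q.hi) :
    B ∈ ramsey := by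
  intro H (hH : H.Infinite) hsub
  obtain ⟨i, hi⟩ := hH.nonempty
  obtain ⟨j, hj, hij⟩ := hH.exists_gt i
  obtain ⟨k, hk, hjk⟩ := hH.exists_gt j
  refine hB _ (hsub (mk_mem_map_r hj hk hjk)) _ (hsub (mk_mem_map_r hi hj hij)) ?_
  rw [Pairs.lo_mk, Pairs.hi_mk]

theorem mem_ramsey_of_finite_fibers {B : Set Pairs} (hB : ∀ c, {p ∈ B | p.lo = c}.Finite) :
    B ∈ ramsey := by
  intro H (hH : H.Infinite) hsub
  obtain ⟨i, hi⟩ := hH.nonempty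
  refine (hH.sdiff (Set.finite_Iic i)) (((hB i).image Pairs.hi).subset fun j hj => ?_)
  have hij : i < j := not_le.1 hj.2
  exact ⟨Pairs.mk i j hij, ⟨hsub (mk_mem_map_r hi hj.1 hij), Pairs.lo_mk hij⟩, Pairs.hi_mk hij⟩

/-! ### Ideals with finite witnesses -/

/-- `A ∉ I` is witnessed by finite subsets of `A`, one satisfying `P k` for each `k`. Long
arithmetic progressions witness `A ∉ vdW`, large partial sums witness `A ∉ summable`. -/
def HasFiniteWitnesses {X : Type*} (I : Set (Set X)) (P : ℕ → Finset X → Prop) : Prop :=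
  ∀ A, A ∉ I ↔ ∀ k, ∃ F, P k F ∧ ↑F ⊆ A

section

variable {X : Type*} {I : Set (Set X)} {P : ℕ → Finset X → Prop}

theorem HasFiniteWitnesses.isLowerSet (hI : HasFiniteWitnesses I P) : IsLowerSet I := by
  intro B A hAB
  contrapose
  rw [hI, hI]
  exact fun hA k => (hA k).imp fun F hF => ⟨hF.1, hF.2.trans hAB⟩

theorem HasFiniteWitnesses.iUnion_notMem (hI : HasFiniteWitnesses I P) {F : ℕ → Finset X}
    (hF : ∀ k, P k (F k)) : ⋃ k, (F k : Set X) ∉ I :=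
  (hI _).2 fun k => ⟨F k, hF k, Set.subset_iUnion (fun k => (F k : Set X)) k⟩

theorem HasFiniteWitnesses.exists_levels (hI : HasFiniteWitnesses I P) {p : Ultrafilter X}
    (hp : ∀ A ∈ p, A ∉ I) {φ : X → ℕ} (hφ : Tendsto φ p atTop) :
    ∃ F : ℕ → Finset X, (∀ n, P n (F n)) ∧ (∀ n, ∀ x ∈ F n, 4 ^ n ≤ φ x) ∧
      (∀ m n, m < n → ∀ x ∈ F m, ∀ y ∈ F n, 2 * φ x < φ y) ∧
      ∀ n, ∀ x ∈ F n, ∀ y ∈ F n, φ x ≡ φ y [MOD n + 1] := by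
  classical
  obtain ⟨F, hF⟩ := exists_seq_of_history (α := Finset X) (Inv := fun _ => True)
    (Q := fun n s F => P n F ∧ (∀ x ∈ F, 4 ^ n ≤ φ x) ∧
      (∀ G ∈ s, ∀ x ∈ G, ∀ y ∈ F, 2 * φ x < φ y) ∧
      ∀ x ∈ F, ∀ y ∈ F, φ x ≡ φ y [MOD n + 1]) trivial fun n s _ => by
    have hbig : ∀ᶠ y in p, 4 ^ n ≤ φ y := hφ.eventually_ge_atTop _
    have hsep : ∀ᶠ y in p, ∀ G ∈ s, ∀ x ∈ G, 2 * φ x < φ y :=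
      (eventually_all_finset s).2 fun G _ => (eventually_all_finset G).2 fun x _ =>
        hφ.eventually_gt_atTop _
    have hmod : ∃ c, ∀ᶠ y in p, φ y % (n + 1) = c := by
      refine (eventually_eq_or_tendsto_atTop p fun y => φ y % (n + 1)).resolve_right fun h => ?_
      obtain ⟨y, hy⟩ := (h.eventually_ge_atTop (n + 1)).exists
      exact (Nat.mod_lt _ n.succ_pos).not_ge hy
    obtain ⟨c, hc⟩ := hmod
    obtain ⟨F, hPF, hF⟩ := (hI _).1 (hp _ (hbig.and (hsep.and hc))) n
    exact ⟨F, ⟨hPF, fun x hx => (hF hx).1, fun G hG x hx y hy => (hF hy).2.1 G hG x hx,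
      fun x hx y hy => (hF hx).2.2.trans (hF hy).2.2.symm⟩, trivial⟩
  exact ⟨F, fun n => (hF n).2.1, fun n => (hF n).2.2.1, fun m n hmn => (hF n).2.2.2.1 _ <|
    Finset.mem_image_of_mem F (Finset.mem_range.2 hmn), fun n => (hF n).2.2.2.2⟩

theorem HasFiniteWitnesses.not_idealLE_diff (hI : HasFiniteWitnesses I P) {p : Ultrafilter X}
    (hp : ∀ A ∈ p, A ∉ I) : ¬ IdealLE diff I := by
  classical
  rintro ⟨φ, hφ⟩
  rcases eventually_eq_or_tendsto_atTop p φ with ⟨c, hc⟩ | hlim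
  · refine hφ _ (hp _ hc) (mem_diff_of_finite ((Set.finite_singleton c).subset ?_))
    exact Set.image_subset_iff.2 subset_rfl
  obtain ⟨F, hPF, -, hsep, hmod⟩ := hI.exists_levels hp hlim
  refine hφ _ (hI.iUnion_notMem hPF) (mem_diff_of_levels (L := fun n => (F n).image φ) ?_ ?_ ?_)
  · simp only [Set.image_iUnion, Finset.coe_image, subset_rfl]
  · simp only [Finset.forall_mem_image]
    exact hsep
  · simp only [Finset.forall_mem_image]
    intro n x hx y hy hxy
    exact Nat.le_of_dvd (Nat.sub_pos_of_lt hxy)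
      ((Nat.modEq_iff_dvd' hxy.le).1 (hmod n x hx y hy))

end

theorem hasFiniteWitnesses_summable : HasFiniteWitnesses summable fun k F =>
    (k : ℝ) ≤ ∑ n ∈ F, 1 / ((n : ℝ) + 1) := by
  classical
  refine fun A => ⟨fun hA k => ?_, fun h hA => ?_⟩
  · by_contra! hsmall
    refine hA (summable_of_sum_le (c := k) (fun _ => by positivity) fun u => ?_)
    by_contra! hlt
    refine hsmall (u.map (Function.Embedding.subtype _)) ?_ (Finset.map_subtype_subset u)
    rw [Finset.sum_map]
    exact hlt.le
  · rw [mem_summable_iff] at hA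
    obtain ⟨k, hk⟩ := exists_nat_gt (∑' n, A.indicator (fun n : ℕ => 1 / ((n : ℝ) + 1)) n)
    obtain ⟨F, hF, hFA⟩ := h k
    have hsum := hA.sum_le_tsum F fun n _ => Set.indicator_nonneg (fun n _ => by positivity) n
    rw [Finset.sum_congr rfl fun n hn => Set.indicator_of_mem (hFA hn) _] at hsum
    exact (hF.trans hsum).not_gt hk

theorem exists_ultrafilter_forall_notMem_summable :
    ∃ p : Ultrafilter ℕ, ∀ A ∈ p, A ∉ summable :=
  exists_ultrafilter_forall_notMem isLowerSet_summable fun _ _ C =>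
    exists_preimage_singleton_notMem_summable C

theorem hasFiniteWitnesses_vdW : HasFiniteWitnesses vdW fun k F =>
    ∃ a d, 0 < d ∧ F = (Finset.range k).image fun i => a + i * d := by
  refine fun A => not_not.trans (forall_congr' fun k => ⟨?_, ?_⟩)
  · rintro ⟨a, d, hd, hA⟩
    refine ⟨_, ⟨a, d, hd, rfl⟩, ?_⟩
    simpa [Set.subset_def] using hA
  · rintro ⟨_, ⟨a, d, hd, rfl⟩, hA⟩
    refine ⟨a, d, hd, ?_⟩
    simpa [Set.subset_def] using hA

theorem exists_preimage_singleton_notMem_vdW {κ : Type*} [Finite κ] (C : ℕ → κ) :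
    ∃ c, C ⁻¹' {c} ∉ vdW := by
  cases nonempty_fintype κ
  by_contra! hC
  simp only [vdW, IsAPSet, Set.mem_ofPred_eq, not_forall] at hC
  choose k hk using hC
  obtain ⟨d, hd, a, c, h⟩ :=
    Combinatorics.exists_mono_homothetic_copy (Finset.range (∑ c, k c)) C
  refine hk c ⟨a, d, hd, fun i hi => ?_⟩
  have hkc : k c ≤ ∑ c, k c :=
    Finset.single_le_sum (f := k) (fun _ _ => Nat.zero_le _) (Finset.mem_univ c)
  have := h i (Finset.mem_range.2 (hi.trans_le hkc))
  rwa [smul_eq_mul, mul_comm, add_comm] at this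

theorem exists_ultrafilter_forall_notMem_vdW : ∃ p : Ultrafilter ℕ, ∀ A ∈ p, A ∉ vdW :=
  exists_ultrafilter_forall_notMem hasFiniteWitnesses_vdW.isLowerSet fun _ _ C =>
    exists_preimage_singleton_notMem_vdW C

theorem not_idealLE_diff_summable : ¬ IdealLE diff summable :=
  let ⟨_, hp⟩ := exists_ultrafilter_forall_notMem_summable
  hasFiniteWitnesses_summable.not_idealLE_diff hp

theorem not_idealLE_diff_vdW : ¬ IdealLE diff vdW :=
  let ⟨_, hp⟩ := exists_ultrafilter_forall_notMem_vdW
  hasFiniteWitnesses_vdW.not_idealLE_diff hp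

theorem not_idealLE_summable_vdW : ¬ IdealLE summable vdW := by
  classical
  rintro ⟨φ, hφ⟩
  obtain ⟨p, hp⟩ := exists_ultrafilter_forall_notMem_vdW
  rcases eventually_eq_or_tendsto_atTop p φ with ⟨c, hc⟩ | hlim
  · refine hφ _ (hp _ hc) (mem_summable_of_finite ((Set.finite_singleton c).subset ?_))
    exact Set.image_subset_iff.2 subset_rfl
  obtain ⟨F, hPF, hbig, -⟩ := hasFiniteWitnesses_vdW.exists_levels hp hlim
  refine hφ _ (hasFiniteWitnesses_vdW.iUnion_notMem hPF)
    (mem_summable_of_levels (L := fun n => (F n).image φ) ?_ (fun n => ?_) ?_)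
  · simp only [Set.image_iUnion, Finset.coe_image, subset_rfl]
  · obtain ⟨a, d, -, hF⟩ := hPF n
    calc ((F n).image φ).card ≤ (F n).card := Finset.card_image_le
      _ ≤ (Finset.range n).card := hF ▸ Finset.card_image_le
      _ ≤ 2 ^ n := by rw [Finset.card_range]; exact Nat.lt_two_pow_self.le
  · simpa only [Finset.forall_mem_image] using hbig

/-! ### Reductions of functions on pairs -/

/-- The values `f (h i) (h n)` with `i < n`: the image of `[H]²` under `{x < y} ↦ f x y`, where `H`
is the range of the increasing sequence `h`. -/
def pairValues (f : ℕ → ℕ → ℕ) (h : ℕ → ℕ) : Set ℕ :=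
  {y | ∃ i n, i < n ∧ f (h i) (h n) = y}

theorem image_map_r_subset_pairValues {φ : Pairs → ℕ} {f : ℕ → ℕ → ℕ}
    (hf : ∀ p, f p.lo p.hi = φ p) {h : ℕ → ℕ} (hh : StrictMono h) :
    φ '' r.map (Set.range h) ⊆ pairValues f h := by
  rintro _ ⟨p, hp, rfl⟩
  obtain ⟨i, hi⟩ := hp (p.1.min'_mem p.nonempty)
  obtain ⟨n, hn⟩ := hp (p.1.max'_mem p.nonempty)
  have hlt : h i < h n := by rw [hi, hn]; exact p.lo_lt_hi
  exact ⟨i, n, hh.lt_iff_lt.1 hlt, by rw [hi, hn]; exact hf p⟩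

section PairValues

variable {p : Ultrafilter ℕ} {f : ℕ → ℕ → ℕ}

theorem exists_pairValues_mem_of_eventually_eq_const (hp : (p : Filter ℕ) ≤ atTop) {c : ℕ}
    (hf : ∀ᶠ i in p, ∀ᶠ x in p, f i x = c) :
    ∃ h, StrictMono h ∧ pairValues f h ∈ summable ∧ pairValues f h ∈ hindman := by
  obtain ⟨h, hh, hc⟩ := exists_strictMono_pairwise hp hf
  have hfin : (pairValues f h).Finite := (Set.finite_singleton c).subset <| by
    rintro _ ⟨i, n, hin, rfl⟩
    exact hc i n hin
  exact ⟨h, hh, mem_summable_of_finite hfin, mem_hindman_of_finite hfin⟩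

theorem exists_pairValues_mem_of_eventually_eq_apply (hp : (p : Filter ℕ) ≤ atTop)
    {g : ℕ → ℕ} (hg : Tendsto g p atTop)
    (hf : ∀ᶠ i in p, ∀ᶠ x in p, f i x = g i ∨ f i x = g x) :
    ∃ h, StrictMono h ∧ pairValues f h ∈ summable ∧ pairValues f h ∈ hindman := by
  have hR : ∀ᶠ i in p, ∀ᶠ x in p, (f i x = g i ∨ f i x = g x) ∧ 0 < g i ∧ 4 * g i < g x := by
    filter_upwards [hf, hg.eventually_gt_atTop 0] with i hi hpos
    filter_upwards [hi, hg.eventually_gt_atTop (4 * g i)] with x hx hlt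
    exact ⟨hx, hpos, hlt⟩
  obtain ⟨h, hh, hR⟩ := exists_strictMono_pairwise hp hR
  have hpos (n : ℕ) : 0 < g (h n) := (hR n (n + 1) n.lt_succ_self).2.1
  have hlac : ∀ m n, m < n → 4 * g (h m) < g (h n) := fun m n hmn => (hR m n hmn).2.2
  have hsub : pairValues f h ⊆ Set.range fun n => g (h n) := by
    rintro _ ⟨i, n, hin, rfl⟩
    rcases (hR i n hin).1 with hi | hn
    · exact ⟨i, hi.symm⟩
    · exact ⟨n, hn.symm⟩
  exact ⟨h, hh, isLowerSet_summable hsub (range_mem_summable_of_lacunary hpos hlac),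
    FS.isLowerSet_ideal hsub (range_mem_hindman_of_lacunary hlac)⟩

/-- The values `f l x` with `l ∈ s` satisfy no equation `u + v = u' + v'` in which the row of `u`
lies strictly above the other three rows. -/
def SidonAt (f : ℕ → ℕ → ℕ) (s : Finset ℕ) (x : ℕ) : Prop :=
  ∀ l ∈ s, ∀ i ∈ s, ∀ j ∈ s, ∀ k ∈ s, i < l → j < l → k < l → f l x + f k x ≠ f i x + f j x

theorem SidonAt.isParallelogramFree {s : Finset ℕ} {x : ℕ} (hs : SidonAt f s x) :
    IsParallelogramFree (s.image fun i => f i x : Finset ℕ) := by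
  intro y a b ha hab h₀ h₁ h₂ h₃
  obtain ⟨i₀, hi₀, h₀⟩ := Finset.mem_image.1 h₀
  obtain ⟨i₁, hi₁, h₁⟩ := Finset.mem_image.1 h₁
  obtain ⟨i₂, hi₂, h₂⟩ := Finset.mem_image.1 h₂
  obtain ⟨i₃, hi₃, h₃⟩ := Finset.mem_image.1 h₃
  have hne {i j : ℕ} (h : f i x ≠ f j x) : i ≠ j := fun hij => h (hij ▸ rfl)
  have h₀₁ := @hne i₀ i₁ (by omega)
  have h₀₂ := @hne i₀ i₂ (by omega)
  have h₀₃ := @hne i₀ i₃ (by omega)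
  have h₁₂ := @hne i₁ i₂ (by omega)
  have h₁₃ := @hne i₁ i₃ (by omega)
  have h₂₃ := @hne i₂ i₃ (by omega)
  have hs₀ := hs i₀ hi₀ i₁ hi₁ i₂ hi₂ i₃ hi₃
  have hs₁ := hs i₁ hi₁ i₀ hi₀ i₃ hi₃ i₂ hi₂
  have hs₂ := hs i₂ hi₂ i₀ hi₀ i₃ hi₃ i₁ hi₁
  have hs₃ := hs i₃ hi₃ i₁ hi₁ i₂ hi₂ i₀ hi₀
  omega

theorem eventually_sidonAt_insert {s : Finset ℕ} (hp : (p : Filter ℕ) ≤ atTop)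
    (hf : ∀ l₀, ¬ ∀ᶠ l in p, ∀ᶠ x in p, f l x = f l₀ x) (hs : ∀ᶠ x in p, SidonAt f s x) :
    ∀ᶠ l in p, ∀ᶠ x in p, SidonAt f (insert l s) x := by
  have hrow (i j k : ℕ) : ∀ᶠ l in p, ∀ᶠ x in p, f l x + f k x ≠ f i x + f j x := by
    have : ¬ ∀ᶠ l in p, ∀ᶠ x in p, f l x + f k x = f i x + f j x := fun h => by
      obtain ⟨l₀, hl₀⟩ := h.exists
      refine hf l₀ (h.mono fun l hl => ?_)
      filter_upwards [hl₀, hl] with x hx₀ hx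
      omega
    simpa only [← Ultrafilter.eventually_not] using this
  have hnew : ∀ᶠ l in p, ∀ i ∈ s, ∀ j ∈ s, ∀ k ∈ s, ∀ᶠ x in p, f l x + f k x ≠ f i x + f j x := by
    simp only [eventually_all_finset]
    exact fun i _ j _ k _ => hrow i j k
  have hgt : ∀ᶠ l in p, ∀ i ∈ s, i < l :=
    (eventually_all_finset s).2 fun i _ => hp (eventually_gt_atTop i)
  filter_upwards [hnew, hgt] with l hl hgt
  simp only [← eventually_all_finset] at hl
  filter_upwards [hl, hs] with x hx hsx
  have hmem {i m : ℕ} (hi : i ∈ insert l s) (him : i < m) (hm : m ∈ insert l s) : i ∈ s := by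
    refine (Finset.mem_insert.1 hi).resolve_left ?_
    rintro rfl
    rcases Finset.mem_insert.1 hm with rfl | hm
    exacts [him.false, (hgt m hm).not_gt him]
  intro m hm i hi j hj k hk him hjm hkm
  rcases Finset.mem_insert.1 hm with rfl | hms
  · exact hx i (hmem hi him hm) j (hmem hj hjm hm) k (hmem hk hkm hm)
  · exact hsx m hms i (hmem hi him hm) j (hmem hj hjm hm) k (hmem hk hkm hm) him hjm hkm

theorem exists_strictMono_sidonAt (hp : (p : Filter ℕ) ≤ atTop)
    (hrow : ∀ᶠ i in p, Tendsto (f i) p atTop)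
    (hf : ∀ l₀, ¬ ∀ᶠ l in p, ∀ᶠ x in p, f l x = f l₀ x) :
    ∃ h, StrictMono h ∧ ∀ n, SidonAt f ((Finset.range n).image h) (h n) ∧
      (∀ i < n, 4 ^ n ≤ f (h i) (h n)) ∧
      ∀ j m, j < m → m < n → ∀ i < n, 2 * f (h j) (h m) < f (h i) (h n) := by
  obtain ⟨h, hh, hseq⟩ := exists_strictMono_of_eventually hp
    (Inv := fun s => (∀ i ∈ s, Tendsto (f i) p atTop) ∧ ∀ᶠ x in p, SidonAt f s x)
    (Q := fun n s x => SidonAt f s x ∧ (∀ i ∈ s, 4 ^ n ≤ f i x) ∧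
      ∀ j ∈ s, ∀ m ∈ s, ∀ i ∈ s, 2 * f j m < f i x) (by simp [SidonAt]) fun n s ⟨hs, hsidon⟩ => by
    have hbig : ∀ᶠ x in p, ∀ i ∈ s, 4 ^ n ≤ f i x :=
      (eventually_all_finset s).2 fun i hi => (hs i hi).eventually_ge_atTop _
    have hsep : ∀ᶠ x in p, ∀ j ∈ s, ∀ m ∈ s, ∀ i ∈ s, 2 * f j m < f i x := by
      simp only [eventually_all_finset]
      exact fun j _ m _ i hi => (hs i hi).eventually_gt_atTop _
    filter_upwards [hsidon, hbig, hsep, hrow, eventually_sidonAt_insert hp hf hsidon]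
      with x hx hbx hsx hrx hix
    exact ⟨⟨hx, hbx, hsx⟩, Finset.forall_mem_insert _ _ _ |>.2 ⟨hrx, hs⟩, hix⟩
  have hmem {i n : ℕ} (hin : i < n) : h i ∈ (Finset.range n).image h :=
    Finset.mem_image_of_mem h (Finset.mem_range.2 hin)
  refine ⟨h, hh, fun n => ⟨(hseq n).2.1, fun i hi => (hseq n).2.2.1 _ (hmem hi), ?_⟩⟩
  exact fun j m hjm hmn i hi =>
    (hseq n).2.2.2 _ (hmem (hjm.trans hmn)) _ (hmem hmn) _ (hmem hi)

theorem exists_pairValues_mem_of_rows_distinct (hp : (p : Filter ℕ) ≤ atTop)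
    (hrow : ∀ᶠ i in p, Tendsto (f i) p atTop)
    (hf : ∀ l₀, ¬ ∀ᶠ l in p, ∀ᶠ x in p, f l x = f l₀ x) :
    ∃ h, StrictMono h ∧ pairValues f h ∈ summable ∧ pairValues f h ∈ hindman := by
  obtain ⟨h, hh, hseq⟩ := exists_strictMono_sidonAt hp hrow hf
  let L (n : ℕ) : Finset ℕ := ((Finset.range n).image h).image fun i => f i (h n)
  have hL : pairValues f h ⊆ ⋃ n, (L n : Set ℕ) := by
    rintro _ ⟨i, n, hin, rfl⟩
    exact Set.mem_iUnion.2 ⟨n, Finset.mem_image_of_mem _ <|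
      Finset.mem_image_of_mem h (Finset.mem_range.2 hin)⟩
  refine ⟨h, hh, mem_summable_of_levels hL (fun n => ?_) fun n => ?_,
    mem_hindman_of_levels hL (fun m n hmn => ?_) fun n => (hseq n).1.isParallelogramFree⟩
  · calc (L n).card ≤ (Finset.range n).card :=
        Finset.card_image_le.trans Finset.card_image_le
      _ ≤ 2 ^ n := by rw [Finset.card_range]; exact Nat.lt_two_pow_self.le
  · simp only [L, Finset.forall_mem_image, Finset.mem_range]
    exact (hseq n).2.1
  · simp only [L, Finset.mem_coe, Finset.forall_mem_image, Finset.mem_range]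
    exact fun j hj i hi => (hseq n).2.2 j m hj hmn i hi

end PairValues

theorem exists_infinite_image_map_r_mem (φ : Pairs → ℕ) :
    ∃ H ∈ r.dom, φ '' r.map H ∈ summable ∧ φ '' r.map H ∈ hindman := by
  obtain ⟨f, hf⟩ := Pairs.exists_apply_lo_hi_eq φ
  suffices h : ∃ h, StrictMono h ∧ pairValues f h ∈ summable ∧ pairValues f h ∈ hindman by
    obtain ⟨h, hh, hS, hH⟩ := h
    have hsub := image_map_r_subset_pairValues hf hh
    exact ⟨Set.range h, Set.infinite_range_of_injective hh.injective,
      isLowerSet_summable hsub hS, FS.isLowerSet_ideal hsub hH⟩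
  let p := hyperfilter ℕ
  have hp : (p : Filter ℕ) ≤ atTop := Nat.hyperfilter_le_atTop
  rcases eventually_rows_eq_or_tendsto_atTop p p f with ⟨g, hg⟩ | hrow
  · rcases eventually_eq_or_tendsto_atTop p g with ⟨c, hc⟩ | hlim
    · refine exists_pairValues_mem_of_eventually_eq_const hp (c := c) ?_
      filter_upwards [hg, hc] with i hi hic
      rwa [hic] at hi
    · exact exists_pairValues_mem_of_eventually_eq_apply hp hlim
        (hg.mono fun i hi => hi.mono fun x => .inl)
  by_cases hne : ∃ l₀, ∀ᶠ l in p, ∀ᶠ x in p, f l x = f l₀ x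
  · obtain ⟨l₀, hl₀⟩ := hne
    obtain ⟨l, hl, hlim⟩ := (hl₀.and hrow).exists
    exact exists_pairValues_mem_of_eventually_eq_apply hp (hlim.congr' hl)
      (hl₀.mono fun i hi => hi.mono fun x => .inr)
  · exact exists_pairValues_mem_of_rows_distinct hp hrow (not_exists.1 hne)

theorem not_idealLE_summable_ramsey : ¬ IdealLE summable ramsey :=
  not_idealLE_of_forall fun φ =>
    let ⟨H, hH, hS, _⟩ := exists_infinite_image_map_r_mem φ
    ⟨H, hH, hS⟩

theorem not_idealLE_hindman_ramsey : ¬ IdealLE hindman ramsey :=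
  not_idealLE_of_forall fun φ =>
    let ⟨H, hH, _, hI⟩ := exists_infinite_image_map_r_mem φ
    ⟨H, hH, hI⟩

/-! ### Sums along an idempotent ultrafilter -/

/-- `p` is nonprincipal and idempotent for the addition of ultrafilters, `p + p = p`. -/
structure IsFreeIdempotent (p : Ultrafilter ℕ) : Prop where
  le_atTop : (p : Filter ℕ) ≤ atTop
  eventually_iff : ∀ P : ℕ → Prop, (∀ᶠ x in p, P x) ↔ ∀ᶠ x in p, ∀ᶠ y in p, P (x + y)

-- The Ellis–Numakura lemma is applied to `ℕ+`: in `ℕ` it could return the principal ultrafilter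
-- at `0`.
attribute [local instance] Ultrafilter.add Ultrafilter.addSemigroup in
theorem exists_isFreeIdempotent : ∃ p : Ultrafilter ℕ, IsFreeIdempotent p := by
  obtain ⟨q, hq⟩ := exists_idempotent_of_compact_t2_of_continuous_add_left
    (Ultrafilter.continuous_add_left (M := ℕ+))
  have hqiff (P : ℕ+ → Prop) : (∀ᶠ x in q, P x) ↔ ∀ᶠ x in q, ∀ᶠ y in q, P (x + y) := by
    conv_lhs => rw [← hq]
    exact Ultrafilter.eventually_add q q P
  refine ⟨q.map (fun x : ℕ+ => (x : ℕ)), ?_, fun P => hqiff fun x => P x⟩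
  refine (eventually_eq_or_tendsto_atTop q fun x : ℕ+ => (x : ℕ)).resolve_left ?_
  rintro ⟨c, hc⟩
  obtain ⟨x, hxc, hxy⟩ := (hc.and ((hqiff _).1 hc)).exists
  obtain ⟨y, hxyc⟩ := hxy.exists
  have hpos := y.pos
  rw [PNat.add_coe] at hxyc
  omega

/-- The sums of nonempty subsets of `s`. -/
def finiteSums (s : Finset ℕ) : Finset ℕ := (s.powerset.erase ∅).image fun α => ∑ i ∈ α, i

theorem mem_finiteSums {s : Finset ℕ} {x : ℕ} :
    x ∈ finiteSums s ↔ ∃ α : Finset ℕ, α.Nonempty ∧ α ⊆ s ∧ ∑ i ∈ α, i = x := by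
  simp only [finiteSums, Finset.mem_image, Finset.mem_erase, Finset.mem_powerset, and_assoc,
    Finset.nonempty_iff_ne_empty]

theorem card_finiteSums_lt (s : Finset ℕ) : (finiteSums s).card < 2 ^ s.card := by
  rw [← Finset.card_powerset]
  exact Finset.card_image_le.trans_lt (Finset.card_erase_lt_of_mem (Finset.empty_mem_powerset s))

theorem eq_or_exists_of_mem_finiteSums_insert {s : Finset ℕ} {x y : ℕ}
    (hx : x ∈ finiteSums (insert y s)) :
    x ∈ finiteSums s ∨ x = y ∨ ∃ z ∈ finiteSums s, x = z + y := by
  obtain ⟨α, hα, hαs, rfl⟩ := mem_finiteSums.1 hx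
  by_cases hy : y ∈ α
  · have hsum := Finset.sum_erase_add α (fun i => i) hy
    rcases (α.erase y).eq_empty_or_nonempty with he | he
    · rw [he, Finset.sum_empty, zero_add] at hsum
      exact .inr (.inl hsum.symm)
    · exact .inr (.inr ⟨_, mem_finiteSums.2 ⟨_, he, Finset.subset_insert_iff.1 hαs, rfl⟩,
        hsum.symm⟩)
  · exact .inl (mem_finiteSums.2 ⟨α, hα, (Finset.subset_insert_iff_of_notMem hy).1 hαs, rfl⟩)

/-- The sums of nonempty subsets of `{d 0, …, d (n - 1)}`. -/
def sumsBefore (d : ℕ → ℕ) (n : ℕ) : Finset ℕ := finiteSums ((Finset.range n).image d)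

/-- The finite sums of `d` whose last term is `d n`. -/
def sumsEndingAt (d : ℕ → ℕ) (n : ℕ) : Finset ℕ :=
  insert (d n) ((sumsBefore d n).image fun z => z + d n)

theorem card_sumsEndingAt_le (d : ℕ → ℕ) (n : ℕ) : (sumsEndingAt d n).card ≤ 2 ^ n := by
  calc (sumsEndingAt d n).card ≤ (sumsBefore d n).card + 1 :=
        (Finset.card_insert_le _ _).trans (Nat.succ_le_succ Finset.card_image_le)
    _ ≤ 2 ^ ((Finset.range n).image d).card := card_finiteSums_lt _
    _ ≤ 2 ^ n := Nat.pow_le_pow_right two_pos (Finset.card_image_le.trans_eq (Finset.card_range n))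

theorem sumsEndingAt_subset_sumsBefore {d : ℕ → ℕ} (hd : StrictMono d) {m n : ℕ} (hmn : m < n) :
    sumsEndingAt d m ⊆ sumsBefore d n := by
  have hm : d m ∈ (Finset.range n).image d := Finset.mem_image_of_mem d (Finset.mem_range.2 hmn)
  intro x hx
  rcases Finset.mem_insert.1 hx with rfl | hx
  · exact mem_finiteSums.2 ⟨{d m}, Finset.singleton_nonempty _, Finset.singleton_subset_iff.2 hm,
      Finset.sum_singleton _ _⟩
  · obtain ⟨z, hz, rfl⟩ := Finset.mem_image.1 hx
    obtain ⟨α, -, hαs, rfl⟩ := mem_finiteSums.1 hz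
    have hmα : d m ∉ α := fun h => by
      obtain ⟨i, hi, him⟩ := Finset.mem_image.1 (hαs h)
      exact (Finset.mem_range.1 hi).ne (hd.injective him)
    refine mem_finiteSums.2 ⟨insert (d m) α, Finset.insert_nonempty _ _, ?_, ?_⟩
    · refine Finset.insert_subset hm (hαs.trans (Finset.image_subset_image ?_))
      exact Finset.range_mono hmn.le
    · rw [Finset.sum_insert hmα, add_comm]

theorem map_FS_range_subset {d : ℕ → ℕ} (hd : StrictMono d) :
    FS.map (Set.range d) ⊆ ⋃ n, (sumsEndingAt d n : Set ℕ) := by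
  rintro _ ⟨α, hα, hαd, rfl⟩
  obtain ⟨n, hn⟩ := hαd (α.max'_mem hα)
  have hnα : d n ∈ α := hn ▸ α.max'_mem hα
  have hbefore : α.erase (d n) ⊆ (Finset.range n).image d := fun y hy => by
    obtain ⟨hyn, hyα⟩ := Finset.mem_erase.1 hy
    obtain ⟨i, rfl⟩ := hαd hyα
    have hle : d i ≤ d n := hn ▸ α.le_max' _ hyα
    exact Finset.mem_image_of_mem d (Finset.mem_range.2 (hd.lt_iff_lt.1 (hle.lt_of_ne hyn)))
  have hsum := Finset.sum_erase_add α (fun i => i) hnα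
  refine Set.mem_iUnion.2 ⟨n, Finset.mem_coe.2 ?_⟩
  rcases (α.erase (d n)).eq_empty_or_nonempty with he | he
  · rw [he, Finset.sum_empty, zero_add] at hsum
    exact Finset.mem_insert.2 (.inl hsum.symm)
  · exact Finset.mem_insert_of_mem (Finset.mem_image.2
      ⟨_, mem_finiteSums.2 ⟨_, he, hbefore, rfl⟩, hsum⟩)

section Idempotent

variable {p : Ultrafilter ℕ} {β : Type*}

theorem exists_strictMono_sums (hp : IsFreeIdempotent p) {G : ℕ → Prop} (hG : ∀ᶠ x in p, G x)
    {Q : ℕ → Finset ℕ → ℕ → Prop} (hQ : ∀ n Z, (∀ z ∈ Z, G z) → ∀ᶠ y in p, Q n Z y) :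
    ∃ d, StrictMono d ∧ ∀ n, Q n (sumsBefore d n) (d n) := by
  obtain ⟨d, hd, hseq⟩ := exists_strictMono_of_eventually hp.le_atTop
    (Inv := fun s => ∀ z ∈ finiteSums s, G z ∧ ∀ᶠ y in p, G (z + y))
    (Q := fun n s y => Q n (finiteSums s) y) (by simp [finiteSums]) fun n s hs => by
    have hsums : ∀ᶠ y in p, ∀ z ∈ finiteSums s, G (z + y) ∧ ∀ᶠ w in p, G (z + y + w) := by
      refine (eventually_all_finset _).2 fun z hz => (hs z hz).2.and ?_
      simpa only [add_assoc] using (hp.eventually_iff _).1 (hs z hz).2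
    filter_upwards [hQ n _ fun z hz => (hs z hz).1, hsums, hG, (hp.eventually_iff G).1 hG]
      with y hQy hsy hGy hGy'
    refine ⟨hQy, fun x hx => ?_⟩
    rcases eq_or_exists_of_mem_finiteSums_insert hx with hx | rfl | ⟨z, hz, rfl⟩
    exacts [hs x hx, ⟨hGy, hGy'⟩, hsy z hz]
  exact ⟨d, hd, fun n => (hseq n).2⟩

/-- The value of `a` at a sum depends only on its first term, along `p`. -/
def IsStable (p : Ultrafilter ℕ) (a : ℕ → β) : Prop := ∀ᶠ x in p, ∀ᶠ y in p, a (x + y) = a x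

/-- Adding a large number to `x` makes `a` large, along `p`. -/
def IsDivergent (p : Ultrafilter ℕ) (a : ℕ → ℕ) : Prop :=
  ∀ᶠ x in p, Tendsto (fun y => a (x + y)) p atTop

theorem isStable_or_isDivergent (hp : IsFreeIdempotent p) (a : ℕ → ℕ) :
    IsStable p a ∨ IsDivergent p a := by
  refine (eventually_rows_eq_or_tendsto_atTop p p fun x y => a (x + y)).imp_left ?_
  rintro ⟨g, hg⟩
  have hag : ∀ᶠ x in p, a x = g x := by
    refine (hp.eventually_iff _).2 ?_
    filter_upwards [hg, (hp.eventually_iff _).1 hg] with x hx hxy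
    filter_upwards [hx, hxy, (hp.eventually_iff _).1 hx] with y hax hy hxyz
    obtain ⟨z, hz, hz'⟩ := (hy.and hxyz).exists
    rw [hax, ← hz, add_assoc, hz']
  filter_upwards [hg, hag] with x hx hax
  rwa [hax]

theorem IsDivergent.tendsto_atTop (hp : IsFreeIdempotent p) {a : ℕ → ℕ} (ha : IsDivergent p a) :
    Tendsto a p atTop := by
  refine Filter.tendsto_atTop.2 fun c => (hp.eventually_iff _).2 ?_
  exact ha.mono fun x hx => hx.eventually_ge_atTop c

theorem exists_eq_apply_of_mem_sumsBefore {a : ℕ → β} {d : ℕ → ℕ}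
    (h : ∀ n, ∀ z ∈ sumsBefore d n, a (z + d n) = a z) {n z : ℕ} (hz : z ∈ sumsBefore d n) :
    ∃ m, a z = a (d m) := by
  induction n generalizing z with
  | zero => simp [sumsBefore, finiteSums] at hz
  | succ n ih =>
    rw [sumsBefore, Finset.range_add_one, Finset.image_insert] at hz
    rcases eq_or_exists_of_mem_finiteSums_insert hz with hz | rfl | ⟨w, hw, rfl⟩
    · exact ih hz
    · exact ⟨n, rfl⟩
    · rw [h n w hw]
      exact ih hw

theorem exists_eq_apply_of_mem_map_FS {a : ℕ → β} {d : ℕ → ℕ} (hd : StrictMono d)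
    (h : ∀ n, ∀ z ∈ sumsBefore d n, a (z + d n) = a z) :
    ∀ x ∈ FS.map (Set.range d), ∃ m, a x = a (d m) := fun x hx => by
  obtain ⟨n, hn⟩ := Set.mem_iUnion.1 (map_FS_range_subset hd hx)
  exact exists_eq_apply_of_mem_sumsBefore h
    (sumsEndingAt_subset_sumsBefore hd n.lt_succ_self hn)

theorem IsStable.exists_strictMono (hp : IsFreeIdempotent p) {a : ℕ → β} (ha : IsStable p a)
    {R : ℕ → ℕ → Prop} (hR : ∀ n, ∀ᶠ y in p, R n y) :
    ∃ d, StrictMono d ∧ (∀ n, R n (d n)) ∧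
      ∀ x ∈ FS.map (Set.range d), ∃ m, a x = a (d m) := by
  obtain ⟨d, hd, hQ⟩ := exists_strictMono_sums hp ha
    (Q := fun n Z y => R n y ∧ ∀ z ∈ Z, a (z + y) = a z)
    fun n Z hZ => (hR n).and ((eventually_all_finset Z).2 hZ)
  exact ⟨d, hd, fun n => (hQ n).1, exists_eq_apply_of_mem_map_FS hd fun n => (hQ n).2⟩

theorem IsDivergent.exists_strictMono (hp : IsFreeIdempotent p) {a : ℕ → ℕ} (ha : IsDivergent p a)
    (c : ℕ → ℕ) : ∃ d, StrictMono d ∧ ∀ n, ∀ x ∈ sumsEndingAt d n, c n ≤ a x := by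
  obtain ⟨d, hd, hQ⟩ := exists_strictMono_sums hp ha
    (Q := fun n Z y => c n ≤ a y ∧ ∀ z ∈ Z, c n ≤ a (z + y)) fun n Z hZ =>
    ((ha.tendsto_atTop hp).eventually_ge_atTop _).and
      ((eventually_all_finset Z).2 fun z hz => (hZ z hz).eventually_ge_atTop _)
  refine ⟨d, hd, fun n => ?_⟩
  simp only [sumsEndingAt, Finset.forall_mem_insert, Finset.forall_mem_image]
  exact hQ n

end Idempotent

theorem not_idealLE_hindman_of_forall {Λ : Type*} {I : Set (Set Λ)}
    (h : ∀ φ : ℕ → Λ, ∃ d : ℕ → ℕ, StrictMono d ∧ φ '' FS.map (Set.range d) ∈ I) :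
    ¬ IdealLE I hindman :=
  not_idealLE_of_forall fun φ =>
    let ⟨d, hd, hI⟩ := h φ
    ⟨Set.range d, Set.infinite_range_of_injective hd.injective, hI⟩

theorem not_idealLE_summable_hindman : ¬ IdealLE summable hindman := by
  refine not_idealLE_hindman_of_forall fun φ => ?_
  obtain ⟨p, hp⟩ := exists_isFreeIdempotent
  rcases isStable_or_isDivergent hp φ with hφ | hφ
  · rcases eventually_eq_or_tendsto_atTop p φ with ⟨c, hc⟩ | hlim
    · obtain ⟨d, hd, hdc, hval⟩ := hφ.exists_strictMono hp fun _ => hc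
      refine ⟨d, hd, mem_summable_of_finite ((Set.finite_singleton c).subset ?_)⟩
      rintro _ ⟨x, hx, rfl⟩
      obtain ⟨m, hm⟩ := hval x hx
      exact hm.trans (hdc m)
    · obtain ⟨d, hd, hdn, hval⟩ := hφ.exists_strictMono hp
        fun n => hlim.eventually_ge_atTop (4 ^ n)
      refine ⟨d, hd, mem_summable_of_levels (L := fun n => {φ (d n)}) ?_ (fun n => ?_) fun n => ?_⟩
      · rintro _ ⟨x, hx, rfl⟩
        obtain ⟨m, hm⟩ := hval x hx
        exact Set.mem_iUnion.2 ⟨m, Finset.mem_coe.2 (Finset.mem_singleton.2 hm)⟩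
      · exact (Finset.card_singleton _).trans_le Nat.one_le_two_pow
      · simp only [Finset.mem_singleton, forall_eq]
        exact hdn n
  · obtain ⟨d, hd, hdn⟩ := hφ.exists_strictMono hp fun n => 4 ^ n
    refine ⟨d, hd, mem_summable_of_levels (L := fun n => (sumsEndingAt d n).image φ) ?_
      (fun n => Finset.card_image_le.trans (card_sumsEndingAt_le d n))
      fun n => Finset.forall_mem_image.2 (hdn n)⟩
    rintro _ ⟨x, hx, rfl⟩
    obtain ⟨n, hn⟩ := Set.mem_iUnion.1 (map_FS_range_subset hd hx)
    exact Set.mem_iUnion.2 ⟨n, Finset.mem_image_of_mem φ hn⟩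

section Idempotent

variable {p : Ultrafilter ℕ}

theorem IsDivergent.eventually_ne {a b : ℕ → ℕ} (hp : IsFreeIdempotent p) (ha : IsStable p a)
    (hb : IsDivergent p b) : ∀ᶠ x in p, b x ≠ a x := by
  refine (hp.eventually_iff _).2 ?_
  filter_upwards [ha, hb] with x hax hbx
  filter_upwards [hax, hbx.eventually_gt_atTop (a x)] with y hay hby
  rw [hay]
  exact hby.ne'

theorem IsDivergent.eventually_add_ne {a b : ℕ → ℕ} (hp : IsFreeIdempotent p)
    (ha : IsStable p a) (hb : IsDivergent p b) :
    ∀ᶠ x in p, ∀ᶠ y in p, b (x + y) ≠ a y := by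
  filter_upwards [(hp.eventually_iff _).1 hb] with x hx
  refine (hp.eventually_iff _).2 ?_
  filter_upwards [ha, hx] with z haz hbz
  filter_upwards [haz, hbz.eventually_gt_atTop (a z)] with y hay hby
  rw [hay, ← add_assoc]
  exact hby.ne'

/-- The conditions on a generator `y`, given the set `Z` of earlier sums, that keep the values of
`a` at generators apart from the values of `b` at sums. -/
structure Separates (a b : ℕ → ℕ) (Z : Finset ℕ) (y : ℕ) : Prop where
  lt_left : ∀ z ∈ Z, b z < a y
  lt_right : ∀ z ∈ Z, a z < b y
  lt_add : ∀ z ∈ Z, ∀ w ∈ Z, a w < b (z + y)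
  ne : b y ≠ a y
  add_ne : ∀ z ∈ Z, b (z + y) ≠ a y

theorem ne_of_separates {a b : ℕ → ℕ} {d : ℕ → ℕ} (hd : StrictMono d)
    (hsep : ∀ n, Separates a b (sumsBefore d n) (d n)) {m n y : ℕ} (hy : y ∈ sumsEndingAt d n) :
    a (d m) ≠ b y := by
  rcases lt_or_ge n m with hnm | hmn
  · exact ((hsep m).lt_left y (sumsEndingAt_subset_sumsBefore hd hnm hy)).ne'
  obtain hmn | rfl := hmn.lt_or_eq
  · have hm : d m ∈ sumsBefore d n :=
      sumsEndingAt_subset_sumsBefore hd hmn (Finset.mem_insert_self _ _)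
    rcases Finset.mem_insert.1 hy with rfl | hy
    · exact ((hsep n).lt_right _ hm).ne
    · obtain ⟨z, hz, rfl⟩ := Finset.mem_image.1 hy
      exact ((hsep n).lt_add z hz _ hm).ne
  · rcases Finset.mem_insert.1 hy with rfl | hy
    · exact (hsep m).ne.symm
    · obtain ⟨z, hz, rfl⟩ := Finset.mem_image.1 hy
      exact ((hsep m).add_ne z hz).symm

theorem exists_strictMono_disjoint {a b : ℕ → ℕ} (hp : IsFreeIdempotent p) (ha : IsStable p a)
    (ha' : Tendsto a p atTop) (hb : IsDivergent p b) :
    ∃ d : ℕ → ℕ, StrictMono d ∧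
      ∀ x ∈ FS.map (Set.range d), ∀ y ∈ FS.map (Set.range d), a x ≠ b y := by
  obtain ⟨d, hd, hQ⟩ := exists_strictMono_sums hp (ha.and (hb.and (hb.eventually_add_ne hp ha)))
    (Q := fun _ Z y => Separates a b Z y ∧ ∀ z ∈ Z, a (z + y) = a z) fun _ Z hZ => by
    have hsum : ∀ᶠ y in p, ∀ z ∈ Z,
        a (z + y) = a z ∧ (∀ w ∈ Z, a w < b (z + y)) ∧ b (z + y) ≠ a y := by
      refine (eventually_all_finset Z).2 fun z hz => ?_
      obtain ⟨hstable, hdiv, hne⟩ := hZ z hz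
      exact hstable.and (((eventually_all_finset Z).2 fun w _ =>
        hdiv.eventually_gt_atTop (a w)).and hne)
    have hlt : ∀ᶠ y in p, ∀ z ∈ Z, b z < a y ∧ a z < b y :=
      (eventually_all_finset Z).2 fun z _ => (ha'.eventually_gt_atTop (b z)).and
        ((hb.tendsto_atTop hp).eventually_gt_atTop (a z))
    filter_upwards [hsum, hlt, hb.eventually_ne hp ha] with y hsum hlt hne
    exact ⟨⟨fun z hz => (hlt z hz).1, fun z hz => (hlt z hz).2, fun z hz => (hsum z hz).2.1, hne,
      fun z hz => (hsum z hz).2.2⟩, fun z hz => (hsum z hz).1⟩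
  refine ⟨d, hd, fun x hx y hy => ?_⟩
  obtain ⟨m, hm⟩ := exists_eq_apply_of_mem_map_FS hd (fun n => (hQ n).2) x hx
  obtain ⟨n, hn⟩ := Set.mem_iUnion.1 (map_FS_range_subset hd hy)
  rw [hm]
  exact ne_of_separates hd (fun n => (hQ n).1) hn

end Idempotent

theorem exists_image_map_FS_mem_ramsey_of_isDivergent {p : Ultrafilter ℕ}
    (hp : IsFreeIdempotent p) {φ : ℕ → Pairs} (hφ : IsDivergent p fun x => (φ x).lo) :
    ∃ d : ℕ → ℕ, StrictMono d ∧ φ '' FS.map (Set.range d) ∈ ramsey := by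
  obtain ⟨d, hd, hdn⟩ := hφ.exists_strictMono hp fun n => n
  refine ⟨d, hd, mem_ramsey_of_finite_fibers fun c => ?_⟩
  have hfin : (⋃ n ∈ Set.Iic c, φ '' (sumsEndingAt d n : Set ℕ)).Finite :=
    (Set.finite_Iic c).biUnion fun n _ => (sumsEndingAt d n).finite_toSet.image φ
  refine hfin.subset ?_
  rintro _ ⟨⟨x, hx, rfl⟩, hxc⟩
  obtain ⟨n, hn⟩ := Set.mem_iUnion.1 (map_FS_range_subset hd hx)
  exact Set.mem_biUnion ((hdn n x hn).trans_eq hxc) (Set.mem_image_of_mem φ hn)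

theorem exists_image_map_FS_mem_ramsey_of_isStable {p : Ultrafilter ℕ}
    (hp : IsFreeIdempotent p) {φ : ℕ → Pairs} (hφ : IsStable p φ)
    (hlim : Tendsto (fun x => (φ x).lo) p atTop) :
    ∃ d : ℕ → ℕ, StrictMono d ∧ φ '' FS.map (Set.range d) ∈ ramsey := by
  obtain ⟨d, hd, hdn, hval⟩ := hφ.exists_strictMono hp fun n => hlim.eventually_ge_atTop n
  refine ⟨d, hd, mem_ramsey_of_finite_fibers fun c => ?_⟩
  refine ((Set.finite_Iic c).image fun n => φ (d n)).subset ?_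
  rintro _ ⟨⟨x, hx, rfl⟩, hxc⟩
  obtain ⟨m, hm⟩ := hval x hx
  refine ⟨m, ?_, hm.symm⟩
  rw [hm] at hxc
  exact (hdn m).trans_eq hxc

theorem not_idealLE_ramsey_hindman : ¬ IdealLE ramsey hindman := by
  refine not_idealLE_hindman_of_forall fun φ => ?_
  obtain ⟨p, hp⟩ := exists_isFreeIdempotent
  rcases isStable_or_isDivergent hp fun x => (φ x).lo with hlo | hlo
  · rcases eventually_eq_or_tendsto_atTop p fun x => (φ x).lo with ⟨c, hc⟩ | hlim
    · obtain ⟨d, hd, hdc, hval⟩ := hlo.exists_strictMono hp fun _ => hc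
      refine ⟨d, hd, mem_ramsey_of_lo_ne_hi ?_⟩
      rintro _ ⟨x, hx, rfl⟩ _ ⟨y, hy, rfl⟩
      obtain ⟨m, hm⟩ := hval x hx
      obtain ⟨n, hn⟩ := hval y hy
      have hlt := (φ y).lo_lt_hi
      rw [hn, hdc n] at hlt
      rw [hm, hdc m]
      exact hlt.ne
    · rcases isStable_or_isDivergent hp fun x => (φ x).hi with hhi | hhi
      · refine exists_image_map_FS_mem_ramsey_of_isStable hp ?_ hlim
        filter_upwards [hlo, hhi] with x hlo hhi
        filter_upwards [hlo, hhi] with y hlo hhi using Pairs.ext hlo hhi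
      · obtain ⟨d, hd, hne⟩ := exists_strictMono_disjoint hp hlo hlim hhi
        refine ⟨d, hd, mem_ramsey_of_lo_ne_hi ?_⟩
        rintro _ ⟨x, hx, rfl⟩ _ ⟨y, hy, rfl⟩
        exact hne x hx y hy
  · exact exists_image_map_FS_mem_ramsey_of_isDivergent hp hlo

end Katetov

theorem mainTheorem9 :
    (¬ Katetov.IdealLE Katetov.hindman Katetov.ramsey ∧
      ¬ Katetov.SetOp.LE Katetov.FS Katetov.r) ∧
    (¬ Katetov.IdealLE Katetov.ramsey Katetov.hindman ∧
      ¬ Katetov.SetOp.LE Katetov.r Katetov.FS) ∧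
    (Katetov.SetOp.LE Katetov.Δ Katetov.FS ∧
      Katetov.diff ⊆ Katetov.hindman ∧
      Katetov.IdealLE Katetov.diff Katetov.hindman) ∧
    (Katetov.SetOp.LE Katetov.Δ Katetov.r ∧
      Katetov.IdealLE Katetov.diff Katetov.ramsey) ∧
    (¬ Katetov.IdealLE Katetov.ramsey Katetov.diff ∧
      ¬ Katetov.SetOp.LE Katetov.r Katetov.Δ) ∧
    (¬ Katetov.IdealLE Katetov.hindman Katetov.diff ∧
      ¬ Katetov.SetOp.LE Katetov.FS Katetov.Δ) ∧
    (¬ Katetov.IdealLE Katetov.summable Katetov.ramsey ∧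
      ¬ Katetov.SetOp.LE (Katetov.SetOp.ofIdeal Katetov.summable) Katetov.r) ∧
    (¬ Katetov.IdealLE Katetov.summable Katetov.hindman ∧
      ¬ Katetov.SetOp.LE (Katetov.SetOp.ofIdeal Katetov.summable) Katetov.FS) ∧
    (¬ Katetov.IdealLE Katetov.summable Katetov.diff ∧
      ¬ Katetov.SetOp.LE (Katetov.SetOp.ofIdeal Katetov.summable) Katetov.Δ) ∧
    (¬ Katetov.IdealLE Katetov.summable Katetov.vdW ∧
      ¬ Katetov.SetOp.LE (Katetov.SetOp.ofIdeal Katetov.summable)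
        (Katetov.SetOp.ofIdeal Katetov.vdW)) ∧
    (¬ Katetov.IdealLE Katetov.diff Katetov.summable ∧
      ¬ Katetov.SetOp.LE Katetov.Δ (Katetov.SetOp.ofIdeal Katetov.summable)) ∧
    (¬ Katetov.IdealLE Katetov.hindman Katetov.summable ∧
      ¬ Katetov.SetOp.LE Katetov.FS (Katetov.SetOp.ofIdeal Katetov.summable)) ∧
    (¬ Katetov.IdealLE Katetov.ramsey Katetov.summable ∧
      ¬ Katetov.SetOp.LE Katetov.r (Katetov.SetOp.ofIdeal Katetov.summable)) ∧
    (¬ Katetov.IdealLE Katetov.diff Katetov.vdW ∧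
      ¬ Katetov.SetOp.LE Katetov.Δ (Katetov.SetOp.ofIdeal Katetov.vdW)) ∧
    (¬ Katetov.IdealLE Katetov.hindman Katetov.vdW ∧
      ¬ Katetov.SetOp.LE Katetov.FS (Katetov.SetOp.ofIdeal Katetov.vdW)) ∧
    (¬ Katetov.IdealLE Katetov.ramsey Katetov.vdW ∧
      ¬ Katetov.SetOp.LE Katetov.r (Katetov.SetOp.ofIdeal Katetov.vdW)) := by
  open Katetov in
  have hDH : IdealLE diff hindman := le_Δ_FS.idealLE diffClosed_Δ
  have hDR : IdealLE diff ramsey := le_Δ_r.idealLE diffClosed_Δ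
  have eS := ideal_ofIdeal isLowerSet_summable
  have eW := ideal_ofIdeal hasFiniteWitnesses_vdW.isLowerSet
  have dS := diffClosed_ofIdeal_summable
  exact ⟨not_idealLE_and_not_le rfl rfl diffClosed_FS not_idealLE_hindman_ramsey,
    not_idealLE_and_not_le rfl rfl diffClosed_r not_idealLE_ramsey_hindman,
    ⟨le_Δ_FS, diff_subset_hindman, hDH⟩, ⟨le_Δ_r, hDR⟩,
    not_idealLE_and_not_le rfl rfl diffClosed_r fun h => not_idealLE_ramsey_hindman (h.trans hDH),
    not_idealLE_and_not_le rfl rfl diffClosed_FS fun h => not_idealLE_hindman_ramsey (h.trans hDR),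
    not_idealLE_and_not_le eS rfl dS not_idealLE_summable_ramsey,
    not_idealLE_and_not_le eS rfl dS not_idealLE_summable_hindman,
    not_idealLE_and_not_le eS rfl dS fun h => not_idealLE_summable_hindman (h.trans hDH),
    not_idealLE_and_not_le eS eW dS not_idealLE_summable_vdW,
    not_idealLE_and_not_le rfl eS diffClosed_Δ not_idealLE_diff_summable,
    not_idealLE_and_not_le rfl eS diffClosed_FS fun h => not_idealLE_diff_summable (hDH.trans h),
    not_idealLE_and_not_le rfl eS diffClosed_r fun h => not_idealLE_diff_summable (hDR.trans h),
    not_idealLE_and_not_le rfl eW diffClosed_Δ not_idealLE_diff_vdW,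
    not_idealLE_and_not_le rfl eW diffClosed_FS fun h => not_idealLE_diff_vdW (hDH.trans h),
    not_idealLE_and_not_le rfl eW diffClosed_r fun h => not_idealLE_diff_vdW (hDR.trans h)⟩
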